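/- Let $\mathbf M=(M_p)_{p\ge 0}$ be a sequence of positive real numbers with $M_0=1$ and quotients $m_p=M_{p+1}/M_p$. Assume that $\mathbf M$ is a weight sequence, i.e. $M_p^2\le M_{p-1}M_{p+1}$ for all $p\ge 1$ and $m_p\to\infty$, and that $\mathbf M$ is derivation closed, i.e. there are $C_0>0$ and $H>1$ with $M_{p+1}\le C_0H^{p+1}M_p$ for all $p\ge 0$ (in other words, $\widehat{\mathbf M}=(p!M_p)_p$ is regular). Let $$\gamma(\mathbf M)=\sup\Big\{\gamma>0:\ \exists a>0\ \ \frac{m_p}{(p+1)^\gamma}\le a\,\frac{m_q}{(q+1)^\gamma}\ \text{ for all } 0\le p\le q\Big\}\in[0,\infty]\qquad(\sup\emptyset=0).$$ For $r>0$ let $S_r=\{z:|\arg z|<r\pi/2\}$ be the unbounded sector of opening $r\pi$ in the Riemann surface of the logarithm. Let $\widetilde{\mathcal A}^u_{(\mathbf M)}(S_r)$ be the space of holomorphic functions $f:S_r\to\mathbb C$ for which there is a formal power series $\widehat f=\sum_{n\ge0}a_nz^n$ such that for every $h>0$ there is $C>0$ with $$\Big|f(z)-\sum_{n=0}^{p-1}a_nz^n\Big|\le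 C\,h^pM_p|z|^p\qquad\text{for all } p\ge 0,\ z\in S_r.$$ The series $\widehat f$ is then uniquely determined by $f$. Let $\mathbb C[[z]]_{(\mathbf M)}$ be the space of formal power series $\sum_{p\ge0} a_pz^p$ with complex coefficients such that $\sup_{p}|a_p|/(h^pM_p)<\infty$ for every $h>0$. If $r>0$ is such that the asymptotic Borel map $\widetilde{\mathcal B}:\widetilde{\mathcal A}^u_{(\mathbf M)}(S_r)\to\mathbb C[[z]]_{(\mathbf M)}$, $f\mapsto\widehat f$, is surjective, then $\gamma(\mathbf M)>\lfloor r\rfloor$. -/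

import Mathlib

noncomputable section

namespace BeurlingBorel

/-! ### Weight sequences -/

/-- The sequence of quotients `m_p = M_{p+1} / M_p`. -/
def quot (M : ℕ → ℝ) (p : ℕ) : ℝ := M (p + 1) / M p

/-- `M` is a weight sequence: positive, normalized by `M_0 = 1`, logarithmically convex,
and its quotients `m_p` (nondecreasing by log-convexity) tend to infinity. -/
structure IsWeightSequence (M : ℕ → ℝ) : Prop where
  pos : ∀ p, 0 < M p
  zero : M 0 = 1
  logConvex : ∀ p, M (p + 1) ^ 2 ≤ M p * M (p + 2)
  quot_tendsto : Filter.Tendsto (quot M) Filter.atTop Filter.atTop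

/-- Derivation closedness (dc). -/
def DerivationClosed (M : ℕ → ℝ) : Prop :=
  ∃ C H : ℝ, 0 < C ∧ 1 < H ∧ ∀ p : ℕ, M (p + 1) ≤ C * H ^ (p + 1) * M p

/-- A real sequence `c` is almost increasing if, for some `a > 0`, `c_p ≤ a c_q` whenever
`p ≤ q`. -/
def AlmostIncreasing (c : ℕ → ℝ) : Prop :=
  ∃ a : ℝ, 0 < a ∧ ∀ p q : ℕ, p ≤ q → c p ≤ a * c q

/-- The index `γ(M) ∈ [0, ∞]`: the supremum of all `g > 0` such that `(m_p / (p + 1) ^ g)_p` is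
almost increasing (the supremum of the empty set being `0`). -/
def gammaIndex (M : ℕ → ℝ) : ENNReal :=
  sSup (ENNReal.ofReal ''
    {g : ℝ | 0 < g ∧ AlmostIncreasing fun p => quot M p / ((p : ℝ) + 1) ^ g})

/-! ### The Riemann surface of the logarithm and its sectors -/

/-- The Riemann surface of the logarithm. A point `z` is given by its logarithm
`log z = log |z| + i arg z`, which may be any complex number: `log` is the global holomorphic
chart, and the covering of `ℂ \ {0}` is `z ↦ exp (log z)`. -/
@[ext] structure LogSurface where
  log : ℂ

namespace LogSurface

/-- The argument of a point (any real number). -/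
def arg (z : LogSurface) : ℝ := z.log.im

/-- The projection of a point to `ℂ \ {0}`. -/
def toComplex (z : LogSurface) : ℂ := Complex.exp z.log

/-- `|z|` is the exponential of the real part of `log z`. -/
theorem norm_toComplex (z : LogSurface) : ‖z.toComplex‖ = Real.exp z.log.re :=
  Complex.norm_exp z.log

/-- A function is holomorphic on a (open) subset of the surface if it is so in the chart `log`. -/
def HolomorphicOn (f : LogSurface → ℂ) (S : Set LogSurface) : Prop :=
  DifferentiableOn ℂ (fun w : ℂ => f ⟨w⟩) {w : ℂ | (⟨w⟩ : LogSurface) ∈ S}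

end LogSurface

/-- The unbounded sector `S_r = {z : |arg z| < r π / 2}` of opening `r π`. -/
def sector (r : ℝ) : Set LogSurface := {z | |z.arg| < r * Real.pi / 2}

/-! ### Uniform asymptotic expansions and ultraholomorphic classes -/

/-- `f` has the formal power series `a` as its uniform `M`-asymptotic expansion in `S`, of type
`1 / h`. -/
def HasUniformExpansion (M : ℕ → ℝ) (h : ℝ) (S : Set LogSurface) (f : LogSurface → ℂ)
    (a : PowerSeries ℂ) : Prop :=
  ∃ C : ℝ, 0 < C ∧ ∀ p : ℕ, ∀ z ∈ S,
    ‖f z - ∑ n ∈ Finset.range p, PowerSeries.coeff n a * z.toComplex ^ n‖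
      ≤ C * h ^ p * M p * ‖z.toComplex‖ ^ p

/-- The functions that are holomorphic in `S` and admit there a uniform `M`-asymptotic expansion
of type `1 / h`. Values outside `S` are irrelevant. -/
def uniformClass (M : ℕ → ℝ) (h : ℝ) (S : Set LogSurface) : Set (LogSurface → ℂ) :=
  {f | LogSurface.HolomorphicOn f S ∧ ∃ a, HasUniformExpansion M h S f a}

/-- The Beurling class of functions with uniform asymptotic expansion: the intersection of the
classes of type `1 / h` over all `h > 0`. -/
def beurlingUniformClass (M : ℕ → ℝ) (S : Set LogSurface) : Set (LogSurface → ℂ) :=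
  ⋂ h ∈ Set.Ioi (0 : ℝ), uniformClass M h S

/-- Formal power series with `sup_p |a_p| / (h ^ p M_p) < ∞`. -/
def seriesClass (M : ℕ → ℝ) (h : ℝ) : Set (PowerSeries ℂ) :=
  {a | ∃ C : ℝ, ∀ p : ℕ, ‖PowerSeries.coeff p a‖ ≤ C * (h ^ p * M p)}

/-- The Beurling space of formal power series `ℂ[[z]]_(M)`. -/
def beurlingSeries (M : ℕ → ℝ) : Set (PowerSeries ℂ) :=
  ⋂ h ∈ Set.Ioi (0 : ℝ), seriesClass M h

/-! ### The asymptotic Borel map -/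

/-- If `c t^p ≤ B t^p + K t^(p+1)` for all `t > 0`, then `c ≤ B`. -/
theorem le_of_forall_pow {c B K : ℝ} {p : ℕ}
    (h : ∀ t : ℝ, 0 < t → c * t ^ p ≤ B * t ^ p + K * t ^ (p + 1)) : c ≤ B := by
  have h1 : ∀ t : ℝ, 0 < t → c ≤ B + K * t := by
    intro t ht
    have h2 := h t ht
    have h3 : 0 < t ^ p := pow_pos ht p
    have h4 : c * t ^ p ≤ (B + K * t) * t ^ p := by
      calc c * t ^ p ≤ B * t ^ p + K * t ^ (p + 1) := h2
        _ = (B + K * t) * t ^ p := by ring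
    exact le_of_mul_le_mul_right h4 h3
  have hc : Filter.Tendsto (fun t : ℝ => B + K * t) (nhdsWithin 0 (Set.Ioi 0)) (nhds B) := by
    have : Continuous fun t : ℝ => B + K * t := by fun_prop
    have h5 := this.tendsto 0
    simp only [mul_zero, add_zero] at h5
    exact h5.mono_left nhdsWithin_le_nhds
  exact ge_of_tendsto hc (by filter_upwards [self_mem_nhdsWithin] with t ht using h1 t ht)

/-- The positive half-line lies in every sector `S_r`, `r > 0`. -/
theorem exists_mem_sector {r : ℝ} (hr : 0 < r) {t : ℝ} (ht : 0 < t) :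
    ∃ z ∈ sector r, z.toComplex = (t : ℂ) := by
  refine ⟨⟨(Real.log t : ℂ)⟩, ?_, ?_⟩
  · have : 0 < r * Real.pi / 2 := by positivity
    simpa [sector, LogSurface.arg] using this
  · rw [LogSurface.toComplex, ← Complex.ofReal_exp, Real.exp_log ht]

/-- The expansion of a function is unique (and does not depend on the type). -/
theorem HasUniformExpansion.unique {M : ℕ → ℝ} {h k r : ℝ} (hr : 0 < r) {f : LogSurface → ℂ}
    {a b : PowerSeries ℂ} (ha : HasUniformExpansion M h (sector r) f a)
    (hb : HasUniformExpansion M k (sector r) f b) : a = b := by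
  obtain ⟨C, -, hC⟩ := ha
  obtain ⟨D, -, hD⟩ := hb
  ext p
  induction p using Nat.strong_induction_on with
  | _ p ih =>
    have key : ‖PowerSeries.coeff p a - PowerSeries.coeff p b‖ ≤ 0 := by
      refine le_of_forall_pow (p := p)
        (K := C * h ^ (p + 1) * M (p + 1) + D * k ^ (p + 1) * M (p + 1)) fun t ht => ?_
      obtain ⟨z, hz, hzt⟩ := exists_mem_sector hr ht
      have h1 := hC (p + 1) z hz
      have h2 := hD (p + 1) z hz
      have hs : ∑ n ∈ Finset.range p, PowerSeries.coeff n a * z.toComplex ^ n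
          = ∑ n ∈ Finset.range p, PowerSeries.coeff n b * z.toComplex ^ n :=
        Finset.sum_congr rfl fun n hn => by rw [ih n (Finset.mem_range.1 hn)]
      rw [Finset.sum_range_succ] at h1 h2
      have hn : ‖z.toComplex‖ = t := by rw [hzt, Complex.norm_real, Real.norm_of_nonneg ht.le]
      have h3 : ‖(PowerSeries.coeff p a - PowerSeries.coeff p b) * z.toComplex ^ p‖ ≤ _ :=
        le_trans (le_of_eq (by rw [hs]; congr 1; ring)) ((norm_sub_le _ _).trans (add_le_add h2 h1))
      rw [norm_mul, norm_pow, hn] at h3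
      linarith
    exact sub_eq_zero.1 (norm_le_zero_iff.1 key)

/-- The coefficients of an expansion of type `1 / h` satisfy the bounds of type `h`. -/
theorem HasUniformExpansion.mem_seriesClass {M : ℕ → ℝ} {h r : ℝ} (hr : 0 < r)
    {f : LogSurface → ℂ} {a : PowerSeries ℂ} (ha : HasUniformExpansion M h (sector r) f a) :
    a ∈ seriesClass M h := by
  obtain ⟨C, -, hC⟩ := ha
  refine ⟨C, fun p => ?_⟩
  refine le_of_forall_pow (p := p) (K := C * h ^ (p + 1) * M (p + 1)) fun t ht => ?_
  obtain ⟨z, hz, hzt⟩ := exists_mem_sector hr ht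
  have h1 := hC p z hz
  have h2 := hC (p + 1) z hz
  rw [Finset.sum_range_succ] at h2
  have hn : ‖z.toComplex‖ = t := by rw [hzt, Complex.norm_real, Real.norm_of_nonneg ht.le]
  have h3 : ‖PowerSeries.coeff p a * z.toComplex ^ p‖ ≤ _ :=
    le_trans (le_of_eq (by congr 1; ring)) ((norm_sub_le _ _).trans (add_le_add h1 h2))
  rw [norm_mul, norm_pow, hn] at h3
  linarith

/-- The expansion of a function of the Beurling class. -/
theorem exists_expansion {M : ℕ → ℝ} {r : ℝ} (hr : 0 < r) {f : LogSurface → ℂ}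
    (hf : f ∈ beurlingUniformClass M (sector r)) :
    ∃ a : PowerSeries ℂ, a ∈ beurlingSeries M ∧
      ∀ h : ℝ, 0 < h → HasUniformExpansion M h (sector r) f a := by
  have hf' : ∀ h : ℝ, 0 < h → ∃ a, HasUniformExpansion M h (sector r) f a :=
    fun h hh => (Set.mem_iInter₂.1 hf h hh).2
  obtain ⟨a, ha⟩ := hf' 1 one_pos
  have hall : ∀ h : ℝ, 0 < h → HasUniformExpansion M h (sector r) f a := by
    intro h hh
    obtain ⟨b, hb⟩ := hf' h hh
    rwa [ha.unique hr hb]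
  exact ⟨a, Set.mem_iInter₂.2 fun h hh => (hall h hh).mem_seriesClass hr, hall⟩

/-- The asymptotic Borel map on the Beurling class in `S_r`: it sends a function to its uniform
asymptotic expansion. -/
def borelMap (M : ℕ → ℝ) {r : ℝ} (hr : 0 < r)
    (f : beurlingUniformClass M (sector r)) : beurlingSeries M :=
  ⟨(exists_expansion hr f.2).choose, (exists_expansion hr f.2).choose_spec.1⟩

/-- The Borel map is characterized by the asymptotic expansion. -/
theorem borelMap_eq_iff (M : ℕ → ℝ) {r : ℝ} (hr : 0 < r)
    (f : beurlingUniformClass M (sector r)) (a : beurlingSeries M) :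
    borelMap M hr f = a ↔
      ∀ h : ℝ, 0 < h → HasUniformExpansion M h (sector r) (f : LogSurface → ℂ) a := by
  have hs := (exists_expansion hr f.2).choose_spec.2
  constructor
  · rintro rfl
    exact hs
  · intro h
    exact Subtype.ext ((hs 1 one_pos).unique hr (h 1 one_pos))

end BeurlingBorel

end

noncomputable section

namespace BeurlingBorel

/-! The proof gives the stronger bound `γ(M) > r`. Write `m_k` for the quotients.

Surjectivity is made quantitative by the open mapping theorem: with a weight `δ` for which `∑ δ_n
y_n z ^ n` is in the Beurling space for all bounded `y`, each `z ^ p` has a lift of type `1` with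
constant `C / δ_p`. A diagonal argument over all such `δ` improves this to `C A ^ p / M_p`
(`exists_monomialLift_geometric`).

Let `f` be such a lift for `p = 2q` and put `G = f / z ^ p - 1`, pulled back to the right half-plane
by `z = ζ ^ r`. The remainders of order `j ≥ p` make `G` small at the origin, by the factors `min 1
(m_k |z|)`, `k ≥ p`. The remainder of order `q` makes `f / z ^ p` at most `1/2` where `|z|` is a
fixed multiple of `1 / m_q`, so `G` is not small there. Jensen's inequality on a circle about that
point, almost touching the origin, limits the total smallness: `∑_{k ≥ 2q} m_k ^ (-1/r) ≤ E q m_q ^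
(-1/r)` (`sum_quot_rpow_le`).

Thus the tails of `x_k = m_k ^ (-1/r)` are at most `D (q + 1) x_q`. Such a condition improves
itself: `x_k (k + 1) ^ (1 + 1/D)` is almost decreasing, hence `m_k / (k + 1) ^ (r (1 + 1/D))` is
almost increasing, and the index exceeds `r`. -/

/-! ### Jensen's inequality and averages over circles. -/

/-- Jensen's inequality: `log ‖f c‖` is at most the circle average of a majorant of `log ‖f‖`. -/
theorem log_norm_center_le_circleAverage {c : ℂ} {R : ℝ} (hR : 0 < R) {f : ℂ → ℂ} {U : ℂ → ℝ}
    (hf : AnalyticOnNhd ℂ f (Metric.closedBall c R)) (hfc : f c ≠ 0)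
    (hU : CircleIntegrable U c R)
    (h : ∀ z ∈ Metric.sphere c R, ‖f z‖ ≤ Real.exp (U z)) :
    Real.log ‖f c‖ ≤ Real.circleAverage U c R := by
  have hRabs : |R| = R := abs_of_pos hR
  have jensen := AnalyticOnNhd.circleAverage_log_norm hR.ne' (by rwa [hRabs]) hfc
  have hsum : 0 ≤ ∑ᶠ u, (MeromorphicOn.divisor f (Metric.closedBall c |R|) u : ℝ)
      * Real.log (R * ‖c - u‖⁻¹) := by
    refine finsum_nonneg fun u => ?_
    by_cases hu : u ∈ Metric.closedBall c |R|
    · refine mul_nonneg ?_ ?_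
      · exact_mod_cast MeromorphicOn.AnalyticOnNhd.divisor_nonneg (by rwa [hRabs]) u
      · rcases eq_or_ne c u with rfl | hcu
        · simp
        · have h0 : 0 < ‖c - u‖ := norm_pos_iff.2 (sub_ne_zero.2 hcu)
          refine Real.log_nonneg ?_
          rw [← div_eq_mul_inv, one_le_div h0, ← dist_eq_norm, dist_comm]
          simpa [hRabs] using hu
    · simp [Function.locallyFinsuppWithin.apply_eq_zero_of_notMem _ hu]
  -- At zeros of `f` the convention `Real.log 0 = 0` could break the bound by `U`; `V` repairs these
  -- values, which the average does not see.
  let V : ℂ → ℝ := fun z => if f z = 0 then U z else Real.log ‖f z‖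
  have hcod : (fun z => Real.log ‖f z‖) =ᶠ[Filter.codiscreteWithin (Metric.sphere c |R|)] V := by
    have h1 := AnalyticOnNhd.preimage_zero_mem_codiscreteWithin hf hfc
      (Metric.mem_closedBall_self hR.le)
      ⟨⟨c, Metric.mem_closedBall_self hR.le⟩, (convex_closedBall c R).isPreconnected⟩
    have h2 := Filter.codiscreteWithin_mono (Metric.sphere_subset_closedBall (x := c) (ε := R)) h1
    rw [hRabs]
    filter_upwards [h2] with z hz
    have hz' : f z ≠ 0 := by simpa using hz
    simp [V, hz']
  have hint : CircleIntegrable (fun z => Real.log ‖f z‖) c R :=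
    (AnalyticOnNhd.mono (s := Metric.sphere c |R|) (t := Metric.closedBall c R) hf
      (by rw [hRabs]; exact Metric.sphere_subset_closedBall)).meromorphicOn.circleIntegrable_log_norm
  have hV : CircleIntegrable V c R := hint.congr_codiscreteWithin hcod
  calc Real.log ‖f c‖ ≤ Real.circleAverage (fun z => Real.log ‖f z‖) c R := by
        rw [jensen]; linarith
    _ = Real.circleAverage V c R := Real.circleAverage_congr_codiscreteWithin hcod hR.ne'
    _ ≤ Real.circleAverage U c R := by
        refine Real.circleAverage_mono hV hU fun z hz => ?_
        rw [hRabs] at hz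
        by_cases hz0 : f z = 0
        · simp [V, hz0]
        · simp only [V, hz0, if_false]
          exact (Real.log_le_iff_le_exp (norm_pos_iff.2 hz0)).2 (h z hz)

/-- On a circle that nearly touches the origin, a nonnegative function that is at least `1` in the
disk of radius `s` about the origin has average at least `d / π`, where `d` is (a lower bound for)
the half-angle under which the disk is seen. -/
theorem le_circleAverage_of_one_le_near_zero {R ρ s d : ℝ} (hρ : 0 < ρ) (hρR : ρ ≤ R)
    (hd : 0 ≤ d) (hdpi : d ≤ Real.pi) (hs : R - ρ + ρ * d ≤ s) {u : ℂ → ℝ}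
    (hu : ContinuousOn u (Metric.sphere (R : ℂ) ρ))
    (hu0 : ∀ z ∈ Metric.sphere (R : ℂ) ρ, 0 ≤ u z)
    (hu1 : ∀ z ∈ Metric.sphere (R : ℂ) ρ, ‖z‖ ≤ s → 1 ≤ u z) :
    d / Real.pi ≤ Real.circleAverage u R ρ := by
  have hmem : ∀ θ, circleMap (R : ℂ) ρ θ ∈ Metric.sphere (R : ℂ) ρ :=
    fun θ => circleMap_mem_sphere _ hρ.le θ
  have hcont : Continuous fun θ : ℝ => u (circleMap R ρ θ) :=
    hu.comp_continuous (continuous_circleMap _ _) hmem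
  have hnorm : ∀ θ : ℝ, |θ - Real.pi| ≤ d → ‖circleMap (R : ℂ) ρ θ‖ ≤ s := by
    intro θ hθ
    -- Measured from `R - ρ`, the point of the circle nearest the origin, the chord is at most the
    -- arc `ρ |θ - π|`.
    have h1 : circleMap (R : ℂ) ρ θ
        = ((R - ρ : ℝ) : ℂ) - ρ * (Complex.exp (Complex.I * ((θ - Real.pi : ℝ) : ℂ)) - 1) := by
      have : Complex.exp (Complex.I * ((θ - Real.pi : ℝ) : ℂ)) = -Complex.exp (θ * Complex.I) := by
        push_cast
        rw [mul_sub, Complex.exp_sub, mul_comm Complex.I (Real.pi : ℂ), Complex.exp_pi_mul_I,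
          mul_comm Complex.I, div_neg, div_one]
      rw [this, circleMap]
      push_cast
      ring
    rw [h1]
    have h2 : ‖Complex.exp (Complex.I * ((θ - Real.pi : ℝ) : ℂ)) - 1‖ ≤ d :=
      (Real.norm_exp_I_mul_ofReal_sub_one_le).trans (by simpa using hθ)
    refine (norm_sub_le _ _).trans (le_trans ?_ hs)
    rw [norm_mul, Complex.norm_real, Complex.norm_real, Real.norm_of_nonneg (sub_nonneg.2 hρR),
      Real.norm_of_nonneg hρ.le]
    gcongr
  have hint : ∀ a b : ℝ, IntervalIntegrable (fun θ : ℝ => u (circleMap R ρ θ))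
      MeasureTheory.volume a b := fun a b => hcont.intervalIntegrable a b
  have h1 : 2 * d ≤ ∫ θ in (Real.pi - d)..(Real.pi + d), u (circleMap R ρ θ) := by
    have := intervalIntegral.integral_mono_on (a := Real.pi - d) (b := Real.pi + d)
      (f := fun _ => (1 : ℝ)) (g := fun θ => u (circleMap R ρ θ)) (μ := MeasureTheory.volume)
      (by linarith) (by simp) (hint _ _) fun θ hθ => hu1 _ (hmem θ)
        (hnorm θ (abs_le.2 ⟨by linarith [hθ.1], by linarith [hθ.2]⟩))
    simp only [intervalIntegral.integral_const, smul_eq_mul, mul_one] at this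
    linarith
  have h2 : ∫ θ in (Real.pi - d)..(Real.pi + d), u (circleMap R ρ θ)
      ≤ ∫ θ in (0 : ℝ)..(2 * Real.pi), u (circleMap R ρ θ) :=
    intervalIntegral.integral_mono_interval (by linarith) (by linarith) (by linarith)
      (Filter.Eventually.of_forall fun θ => hu0 _ (hmem θ)) (hint _ _)
  rw [Real.circleAverage_def, smul_eq_mul]
  calc d / Real.pi = (2 * Real.pi)⁻¹ * (2 * d) := by field_simp
    _ ≤ _ := by
      have := Real.pi_pos
      gcongr
      exact h1.trans h2

/-! ### Self-improvement of the tail condition. -/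

/-- Decay of the tails of a series whose tails are dominated by `D (q + 1) x_q`. -/
theorem tail_mul_rpow_antitone {x : ℕ → ℝ} (hx : ∀ k, 0 < x k) {D : ℝ} (hD : 1 ≤ D)
    (h : ∀ q N, ∑ k ∈ Finset.Ico q N, x k ≤ D * (q + 1) * x q) {p q N : ℕ} (hpq : p ≤ q)
    (hqN : q ≤ N) :
    (∑ k ∈ Finset.Ico q N, x k) * ((q : ℝ) + 1) ^ (1 / D)
      ≤ (∑ k ∈ Finset.Ico p N, x k) * ((p : ℝ) + 1) ^ (1 / D) := by
  have hD0 : 0 < D := by linarith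
  induction q, hpq using Nat.le_induction with
  | base => exact le_rfl
  | succ q hpq ih =>
    refine le_trans ?_ (ih (by omega))
    have hT : ∑ k ∈ Finset.Ico q N, x k = x q + ∑ k ∈ Finset.Ico (q + 1) N, x k :=
      Finset.sum_eq_sum_Ico_succ_bot (by omega) _
    set T := ∑ k ∈ Finset.Ico q N, x k
    set T' := ∑ k ∈ Finset.Ico (q + 1) N, x k
    have hT'0 : 0 ≤ T' := Finset.sum_nonneg fun k _ => (hx k).le
    have hq : (0 : ℝ) < q + 1 := by positivity
    -- Dropping `x q` shrinks the tail by a factor at most `1 - e`, while by Bernoulli (exponent `1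
    -- / D ≤ 1`) the power grows by at most `1 + e`.
    set e : ℝ := 1 / D * (1 / ((q : ℝ) + 1)) with he
    have he0 : 0 < e := by positivity
    have hxe : T * e ≤ x q := by
      have := h q N
      rw [he, ← mul_assoc, mul_one_div, mul_one_div, div_div, div_le_iff₀ (by positivity)]
      linarith
    have hpow : (((q + 1 : ℕ) : ℝ) + 1) ^ (1 / D) ≤ ((q : ℝ) + 1) ^ (1 / D) * (1 + e) := by
      have h1 : (((q + 1 : ℕ) : ℝ) + 1) = ((q : ℝ) + 1) * (1 + 1 / ((q : ℝ) + 1)) := by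
        push_cast; field_simp
      rw [h1, Real.mul_rpow hq.le (by positivity)]
      gcongr
      exact rpow_one_add_le_one_add_mul_self (by linarith [show 0 < 1 / ((q : ℝ) + 1) by positivity])
        (by positivity) ((div_le_one hD0).2 hD)
    have hT' : T' ≤ T * (1 - e) := by linarith
    have hT0 : 0 ≤ T := by linarith [hx q]
    calc T' * (((q + 1 : ℕ) : ℝ) + 1) ^ (1 / D)
        ≤ T' * (((q : ℝ) + 1) ^ (1 / D) * (1 + e)) := by gcongr
      _ ≤ T * (1 - e) * (((q : ℝ) + 1) ^ (1 / D) * (1 + e)) := by gcongr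
      _ = T * ((q : ℝ) + 1) ^ (1 / D) * (1 - e ^ 2) := by ring
      _ ≤ T * ((q : ℝ) + 1) ^ (1 / D) := by
        refine mul_le_of_le_one_right (by positivity) ?_
        nlinarith

/-- By monotonicity the tail from `n / 2` contains about `n / 2` terms that are at least `x n`, so
the decay of tails passes to single terms and gains one power of `n`. If `n < 2 * p`, monotonicity
of `x` suffices. -/
theorem mul_rpow_almost_decreasing {x : ℕ → ℝ} (hx : ∀ k, 0 < x k) (hanti : Antitone x) {D : ℝ}
    (hD : 1 ≤ D) (h : ∀ q N, ∑ k ∈ Finset.Ico q N, x k ≤ D * (q + 1) * x q) {p n : ℕ}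
    (hpn : p ≤ n) :
    x n * ((n : ℝ) + 1) ^ (1 + 1 / D) ≤ 2 ^ (1 + 1 / D) * D * (x p * ((p : ℝ) + 1) ^ (1 + 1 / D)) := by
  have hD0 : 0 < D := by linarith
  set s : ℝ := 1 + 1 / D with hs
  have hs0 : 0 < s := by positivity
  have hsplit : ∀ y : ℝ, 0 < y → y ^ s = y * y ^ (1 / D) := fun y hy => by
    rw [hs, Real.rpow_add hy, Real.rpow_one]
  rcases lt_or_ge n (2 * p) with hn | hn
  · have h1 : (n : ℝ) + 1 ≤ 2 * (p + 1) := by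
      have : (n : ℝ) ≤ 2 * p := by exact_mod_cast hn.le
      linarith
    calc x n * ((n : ℝ) + 1) ^ s ≤ x p * (2 * ((p : ℝ) + 1)) ^ s := by
          gcongr
          · exact (hx p).le
          · exact hanti hpn
      _ = 2 ^ s * 1 * (x p * ((p : ℝ) + 1) ^ s) := by
          rw [Real.mul_rpow (by norm_num) (by positivity)]; ring
      _ ≤ 2 ^ s * D * (x p * ((p : ℝ) + 1) ^ s) := by
          have := hx p
          gcongr
  · obtain ⟨q, hq⟩ : ∃ q, q = n / 2 := ⟨_, rfl⟩
    have hpq : p ≤ q := by omega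
    have hqn : q ≤ n + 1 := by omega
    have hq1 : ((n : ℝ) + 1) / 2 ≤ q + 1 := by
      have : n ≤ 2 * q + 1 := by omega
      have : (n : ℝ) ≤ 2 * q + 1 := by exact_mod_cast this
      linarith
    have hq2 : ((n : ℝ) + 1) / 2 ≤ (n + 1 - q : ℕ) := by
      have : n + 1 ≤ 2 * (n + 1 - q) := by omega
      have : (n : ℝ) + 1 ≤ 2 * (n + 1 - q : ℕ) := by exact_mod_cast this
      linarith
    have hlow : (n + 1 - q : ℕ) * x n ≤ ∑ k ∈ Finset.Ico q (n + 1), x k := by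
      have := Finset.card_nsmul_le_sum (Finset.Ico q (n + 1)) x (x n) fun k hk =>
        hanti (by have := (Finset.mem_Ico.1 hk).2; omega)
      simpa using this
    have hn0 : (0 : ℝ) < (n + 1) / 2 := by positivity
    calc x n * ((n : ℝ) + 1) ^ s = 2 ^ s * (((n : ℝ) + 1) / 2 * x n * (((n : ℝ) + 1) / 2) ^ (1 / D)) := by
          rw [mul_right_comm, ← hsplit _ hn0, Real.div_rpow (by positivity) (by norm_num)]
          field_simp
      _ ≤ 2 ^ s * ((∑ k ∈ Finset.Ico q (n + 1), x k) * ((q : ℝ) + 1) ^ (1 / D)) := by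
          have h1 : ((n : ℝ) + 1) / 2 * x n ≤ ∑ k ∈ Finset.Ico q (n + 1), x k :=
            le_trans (by have := hx n; gcongr) hlow
          have h0 : 0 ≤ ((n : ℝ) + 1) / 2 * x n := by have := hx n; positivity
          gcongr
          exact h0.trans h1
      _ ≤ 2 ^ s * ((∑ k ∈ Finset.Ico p (n + 1), x k) * ((p : ℝ) + 1) ^ (1 / D)) := by
          gcongr 2 ^ s * ?_
          exact tail_mul_rpow_antitone hx hD h hpq hqn
      _ ≤ 2 ^ s * (D * (p + 1) * x p * ((p : ℝ) + 1) ^ (1 / D)) := by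
          gcongr
          exact h p _
      _ = 2 ^ s * D * (x p * ((p : ℝ) + 1) ^ s) := by
          rw [hsplit ((p : ℝ) + 1) (by positivity)]; ring

/-! ### Lifts of monomials with norm control. -/

/-- Existence of a holomorphic function in `S_r` that has the uniform asymptotic expansion `z ^ p`
of type `1`, with constant `K`. -/
def HasMonomialLift (M : ℕ → ℝ) (r : ℝ) (p : ℕ) (K : ℝ) : Prop :=
  ∃ f : LogSurface → ℂ, LogSurface.HolomorphicOn f (sector r) ∧
    ∀ j : ℕ, ∀ z ∈ sector r,
      ‖f z - ∑ n ∈ Finset.range j, PowerSeries.coeff n (PowerSeries.X ^ p) * z.toComplex ^ n‖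
        ≤ K * M j * ‖z.toComplex‖ ^ j

theorem HasMonomialLift.mono {M : ℕ → ℝ} (hM : ∀ j, 0 < M j) {r : ℝ} {p : ℕ} {K K' : ℝ}
    (hK : K ≤ K') (h : HasMonomialLift M r p K) : HasMonomialLift M r p K' := by
  obtain ⟨f, hf, hb⟩ := h
  refine ⟨f, hf, fun j z hz => (hb j z hz).trans ?_⟩
  have := hM j
  gcongr

theorem isOpen_sector_chart (r : ℝ) : IsOpen {w : ℂ | (⟨w⟩ : LogSurface) ∈ sector r} :=
  isOpen_lt (Complex.continuous_im.abs) continuous_const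

theorem LogSurface.toComplex_ne_zero (z : LogSurface) : z.toComplex ≠ 0 := Complex.exp_ne_zero _

/-- The function in the chart `log` given by a function on the sector. -/
def chartExtension {r : ℝ} (u : sector r → ℂ) (w : ℂ) : ℂ :=
  open Classical in if h : (⟨w⟩ : LogSurface) ∈ sector r then u ⟨⟨w⟩, h⟩ else 0

/-- Pairs of a bounded sequence `y` and a function with uniform expansion `∑ δ_n y_n z ^ n` of
type `1`, the latter represented by its normalized remainders. -/
def expansionPairs (M δ : ℕ → ℝ) (r : ℝ) :
    Submodule ℂ (lp (fun _ : ℕ => ℂ) ⊤ × lp (fun _ : ℕ × sector r => ℂ) ⊤) where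
  carrier := {x | (∀ (j : ℕ) (z : sector r), x.2 (j, z) * (M j * ‖z.1.toComplex‖ ^ j : ℝ)
      = x.2 (0, z) - ∑ n ∈ Finset.range j, (δ n * x.1 n) * z.1.toComplex ^ n) ∧
    DifferentiableOn ℂ (chartExtension fun z => x.2 (0, z))
      {w : ℂ | (⟨w⟩ : LogSurface) ∈ sector r}}
  zero_mem' := by
    refine ⟨fun j z => by simp, ?_⟩
    have : (chartExtension fun z : sector r =>
        (0 : lp (fun _ : ℕ × sector r => ℂ) ⊤) (0, z)) = fun _ => 0 := by
      ext w; simp [chartExtension]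
    simp only [Prod.snd_zero, this]
    exact differentiableOn_const _
  add_mem' := by
    rintro x y ⟨hx, hx'⟩ ⟨hy, hy'⟩
    refine ⟨fun j z => ?_, ?_⟩
    · simp only [Prod.fst_add, Prod.snd_add, lp.coeFn_add, Pi.add_apply, add_mul, mul_add,
        Finset.sum_add_distrib, hx j z, hy j z]
      ring
    · refine (hx'.add hy').congr fun w hw => ?_
      have hw' : (⟨w⟩ : LogSurface) ∈ sector r := hw
      simp [chartExtension, hw']
  smul_mem' := by
    rintro c x ⟨hx, hx'⟩
    refine ⟨fun j z => ?_, ?_⟩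
    · simp only [Prod.smul_fst, Prod.smul_snd, lp.coeFn_smul, Pi.smul_apply, smul_eq_mul, mul_assoc,
        hx j z, mul_sub, Finset.mul_sum]
      congr 1
      exact Finset.sum_congr rfl fun n _ => by ring
    · refine (hx'.const_mul c).congr fun w hw => ?_
      have hw' : (⟨w⟩ : LogSurface) ∈ sector r := hw
      simp [chartExtension, hw']

theorem continuous_lp_top_apply {ι : Type*} (i : ι) :
    Continuous fun x : lp (fun _ : ι => ℂ) ⊤ => x i :=
  (lp.lipschitzWith_one_eval (E := fun _ : ι => ℂ) ⊤ i).continuous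

theorem isClosed_expansionPairs (M δ : ℕ → ℝ) (r : ℝ) :
    IsClosed (expansionPairs M δ r :
      Set (lp (fun _ : ℕ => ℂ) ⊤ × lp (fun _ : ℕ × sector r => ℂ) ⊤)) := by
  have h1 : IsClosed {x : lp (fun _ : ℕ => ℂ) ⊤ × lp (fun _ : ℕ × sector r => ℂ) ⊤ |
      ∀ (j : ℕ) (z : sector r), x.2 (j, z) * (M j * ‖z.1.toComplex‖ ^ j : ℝ)
        = x.2 (0, z) - ∑ n ∈ Finset.range j, (δ n * x.1 n) * z.1.toComplex ^ n} := by
    simp only [Set.ofPred_forall]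
    refine isClosed_iInter fun j => isClosed_iInter fun z => isClosed_eq ?_ ?_
    · exact ((continuous_lp_top_apply (j, z)).comp continuous_snd).mul continuous_const
    · refine ((continuous_lp_top_apply (0, z)).comp continuous_snd).sub ?_
      refine continuous_finsetSum _ fun n _ => ?_
      exact (continuous_const.mul ((continuous_lp_top_apply n).comp continuous_fst)).mul
        continuous_const
  have h2 : IsClosed {x : lp (fun _ : ℕ => ℂ) ⊤ × lp (fun _ : ℕ × sector r => ℂ) ⊤ |
      DifferentiableOn ℂ (chartExtension fun z => x.2 (0, z))
        {w : ℂ | (⟨w⟩ : LogSurface) ∈ sector r}} := by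
    refine IsSeqClosed.isClosed fun x x₀ hx hlim => ?_
    refine TendstoLocallyUniformlyOn.differentiableOn (φ := Filter.atTop)
      (F := fun k => chartExtension fun z => (x k).2 (0, z)) ?_
      (Filter.Eventually.of_forall hx) (isOpen_sector_chart r)
    refine TendstoUniformlyOn.tendstoLocallyUniformlyOn ?_
    rw [Metric.tendstoUniformlyOn_iff]
    intro ε hε
    have hlim2 : Filter.Tendsto (fun k => (x k).2) Filter.atTop (nhds x₀.2) :=
      (continuous_snd.tendsto _).comp hlim
    filter_upwards [Metric.tendsto_nhds.1 hlim2 ε hε] with k hk w hw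
    have hw' : (⟨w⟩ : LogSurface) ∈ sector r := hw
    rw [dist_comm]
    refine lt_of_le_of_lt ?_ hk
    simp only [chartExtension, hw', dif_pos, dist_eq_norm]
    exact lp.norm_apply_le_norm ENNReal.top_ne_zero ((x k).2 - x₀.2) (0, ⟨⟨w⟩, hw'⟩)
  exact h1.inter h2

/-- The projection of `expansionPairs` to the sequence `y` is a surjection of Banach spaces, so by
the open mapping theorem the unit vectors have preimages of bounded norm. Dividing by `δ p` yields
the lift. -/
theorem exists_monomialLift_of_surjective {M : ℕ → ℝ} (hM : IsWeightSequence M) {r : ℝ}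
    (hr : 0 < r) (hsurj : Function.Surjective (borelMap M hr)) {δ : ℕ → ℝ} (hδ : ∀ n, 0 < δ n)
    (hδM : ∀ h : ℝ, 0 < h → ∃ C : ℝ, ∀ n, δ n ≤ C * (h ^ n * M n)) :
    ∃ C : ℝ, ∀ p, HasMonomialLift M r p (C / δ p) := by
  let Z := expansionPairs M δ r
  have hZ : CompleteSpace Z := (isClosed_expansionPairs M δ r).completeSpace_coe
  let π : Z →L[ℂ] lp (fun _ : ℕ => ℂ) ⊤ := (ContinuousLinearMap.fst ℂ _ _).comp Z.subtypeL
  have hden : ∀ (j : ℕ) (z : LogSurface), 0 < M j * ‖z.toComplex‖ ^ j := fun j z =>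
    mul_pos (hM.pos j) (pow_pos (norm_pos_iff.2 z.toComplex_ne_zero) j)
  have hπ : Function.Surjective π := by
    intro y
    have ha : PowerSeries.mk (fun n => (δ n : ℂ) * y n) ∈ beurlingSeries M := by
      refine Set.mem_iInter₂.2 fun h hh => ?_
      obtain ⟨C, hC⟩ := hδM h hh
      refine ⟨C * ‖y‖, fun n => ?_⟩
      rw [PowerSeries.coeff_mk, norm_mul, Complex.norm_real, Real.norm_of_nonneg (hδ n).le]
      calc δ n * ‖y n‖ ≤ C * (h ^ n * M n) * ‖y‖ :=
            mul_le_mul (hC n) (lp.norm_apply_le_norm ENNReal.top_ne_zero y n) (norm_nonneg _)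
              ((hδ n).le.trans (hC n))
        _ = C * ‖y‖ * (h ^ n * M n) := by ring
    obtain ⟨f, hf⟩ := hsurj ⟨_, ha⟩
    obtain ⟨C, -, hC⟩ := (borelMap_eq_iff M hr f _).1 hf 1 one_pos
    have hhol : LogSurface.HolomorphicOn (f : LogSurface → ℂ) (sector r) :=
      (Set.mem_iInter₂.1 f.2 1 (Set.mem_Ioi.2 one_pos)).1
    simp only [PowerSeries.coeff_mk, one_pow, mul_one] at hC
    let v : ℕ × sector r → ℂ := fun x => (f.1 x.2.1 - ∑ n ∈ Finset.range x.1,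
      ((δ n : ℂ) * y n) * x.2.1.toComplex ^ n) / (M x.1 * ‖x.2.1.toComplex‖ ^ x.1 : ℝ)
    have hv : Memℓp v ⊤ := by
      refine memℓp_infty ⟨C, ?_⟩
      rintro _ ⟨⟨j, z⟩, rfl⟩
      simp only [v]
      rw [norm_div, Complex.norm_real, Real.norm_of_nonneg (hden j z).le, div_le_iff₀ (hden j z),
        ← mul_assoc]
      exact hC j z z.2
    have hv0 : ∀ z : sector r, v (0, z) = f.1 z.1 := fun z => by simp [v, hM.zero]
    refine ⟨⟨(y, ⟨v, hv⟩), fun j z => ?_, ?_⟩, rfl⟩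
    · change v (j, z) * _ = v (0, z) - _
      rw [hv0]
      exact div_mul_cancel₀ _ (Complex.ofReal_ne_zero.2 (hden j z).ne')
    · refine DifferentiableOn.congr hhol fun w hw => ?_
      have hw' : (⟨w⟩ : LogSurface) ∈ sector r := hw
      simp only [chartExtension, hw', dif_pos]
      exact hv0 _
  obtain ⟨C, hC0, hC⟩ := π.exists_preimage_norm_le hπ
  refine ⟨C, fun p => ?_⟩
  obtain ⟨⟨⟨y, u⟩, hrem, hdiff⟩, hy, hnorm⟩ := hC (lp.single ⊤ p (1 : ℂ))
  have hy' : y = lp.single ⊤ p (1 : ℂ) := hy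
  have hu : ‖u‖ ≤ C := by
    have h1 : ‖u‖ ≤ ‖(y, u)‖ := norm_snd_le (y, u)
    have h2 : ‖(lp.single ⊤ p (1 : ℂ) : lp (fun _ : ℕ => ℂ) ⊤)‖ = 1 := by
      rw [lp.norm_single (by simp)]; simp
    rw [h2, mul_one] at hnorm
    exact h1.trans hnorm
  have hδp : (δ p : ℂ) ≠ 0 := Complex.ofReal_ne_zero.2 (hδ p).ne'
  refine ⟨fun z => chartExtension (fun z => u (0, z)) z.log / δ p, hdiff.div_const _,
    fun j z hz => ?_⟩
  have h1 : chartExtension (fun z => u (0, z)) z.log = u (0, ⟨z, hz⟩) := by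
    have hz' : (⟨z.log⟩ : LogSurface) ∈ sector r := hz
    simp only [chartExtension, hz', dif_pos]
  have h2 := hrem j ⟨z, hz⟩
  have h3 : ∑ n ∈ Finset.range j, ((δ n : ℂ) * y n) * z.toComplex ^ n
      = δ p * ∑ n ∈ Finset.range j, PowerSeries.coeff n (PowerSeries.X ^ p) * z.toComplex ^ n := by
    rw [Finset.mul_sum]
    refine Finset.sum_congr rfl fun n _ => ?_
    rw [hy', PowerSeries.coeff_X_pow]
    rcases eq_or_ne n p with rfl | hn
    · simp
    · simp [hn]
  simp only at h2
  rw [h3] at h2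
  have h4 : u (0, ⟨z, hz⟩) / δ p
      - ∑ n ∈ Finset.range j, PowerSeries.coeff n (PowerSeries.X ^ p) * z.toComplex ^ n
      = u (j, ⟨z, hz⟩) * (M j * ‖z.toComplex‖ ^ j : ℝ) / δ p := by
    rw [h2]; field_simp
  change ‖chartExtension (fun z => u (0, z)) z.log / δ p - _‖ ≤ _
  rw [h1, h4, norm_div, norm_mul, Complex.norm_real, Complex.norm_real,
    Real.norm_of_nonneg (hden j z).le, Real.norm_of_nonneg (hδ p).le]
  have h5 : ‖u (j, ⟨z, hz⟩)‖ ≤ C :=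
    (lp.norm_apply_le_norm ENNReal.top_ne_zero u (j, ⟨z, hz⟩)).trans hu
  calc ‖u (j, ⟨z, hz⟩)‖ * (M j * ‖z.toComplex‖ ^ j) / δ p
      ≤ C * (M j * ‖z.toComplex‖ ^ j) / δ p := by
        have := (hden j z).le
        have := hδ p
        gcongr
    _ = C / δ p * M j * ‖z.toComplex‖ ^ j := by ring

/-- For surjective Borel maps the monomials have lifts whose norms grow geometrically, relative to
`1 / M_p`. -/
theorem exists_monomialLift_geometric {M : ℕ → ℝ} (hM : IsWeightSequence M) {r : ℝ}
    (hr : 0 < r) (hsurj : Function.Surjective (borelMap M hr)) :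
    ∃ C A : ℝ, 1 ≤ C ∧ 1 ≤ A ∧ ∀ p, HasMonomialLift M r p (C * A ^ p / M p) := by
  -- The weight `M n / g n ^ n` is admissible since eventually `g n ≥ 1 / h`.
  have hbound : ∀ g : ℕ → ℝ, (∀ n, 1 ≤ g n) → Filter.Tendsto g Filter.atTop Filter.atTop →
      ∃ C : ℝ, 1 ≤ C ∧ ∀ p, HasMonomialLift M r p (C * g p ^ p / M p) := by
    intro g hg hlim
    have hgpos : ∀ n, 0 < g n := fun n => lt_of_lt_of_le one_pos (hg n)
    obtain ⟨C, hC⟩ := exists_monomialLift_of_surjective hM hr hsurj (δ := fun n => M n / g n ^ n)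
      (fun n => div_pos (hM.pos n) (pow_pos (hgpos n) n)) (by
        intro h hh
        obtain ⟨N, hN⟩ := Filter.eventually_atTop.1 (hlim.eventually_ge_atTop h⁻¹)
        refine ⟨max 1 ((h ^ N)⁻¹), fun n => ?_⟩
        have hMn := hM.pos n
        rw [div_eq_mul_inv, mul_comm, ← mul_assoc]
        gcongr
        rcases le_total N n with hn | hn
        · calc (g n ^ n)⁻¹ ≤ ((h⁻¹) ^ n)⁻¹ := by
                have := hN n hn
                gcongr
            _ = 1 * h ^ n := by simp
            _ ≤ _ := by gcongr; exact le_max_left _ _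
        · have h1 : (g n ^ n)⁻¹ ≤ 1 := inv_le_one_of_one_le₀ (one_le_pow₀ (hg n))
          rcases le_total 1 h with h1h | hh1
          · calc (g n ^ n)⁻¹ ≤ 1 * 1 := by simpa using h1
              _ ≤ _ := mul_le_mul (le_max_left _ _) (one_le_pow₀ h1h) zero_le_one (by positivity)
          · calc (g n ^ n)⁻¹ ≤ 1 := h1
              _ = (h ^ N)⁻¹ * h ^ N := (inv_mul_cancel₀ (by positivity)).symm
              _ ≤ _ := mul_le_mul (le_max_right _ _) (pow_le_pow_of_le_one hh.le hh1 hn)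
                (by positivity) (by positivity))
    refine ⟨max 1 C, le_max_left _ _, fun p => (hC p).mono hM.pos ?_⟩
    have h1 := hM.pos p
    have h2 := hgpos p
    rw [div_div_eq_mul_div]
    gcongr
    exact le_max_right _ _
  by_contra hcon
  push Not at hcon
  -- If the constants `(n + 1) ^ (2p) / M p` worked from some `N` on, the case `g p = p + 1` would
  -- cover the finitely many remaining `p`, against `hcon`.
  have hfreq : ∀ n : ℕ, ∃ᶠ p in Filter.atTop,
      ¬ HasMonomialLift M r p ((((n : ℝ) + 1) ^ 2) ^ p / M p) := by
    intro n hev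
    simp only [not_not] at hev
    obtain ⟨N, hN⟩ := Filter.eventually_atTop.1 hev
    obtain ⟨C, hC1, hC⟩ := hbound (fun p => (p : ℝ) + 1) (fun p => by simp)
      (Filter.tendsto_atTop_add_const_right _ _ tendsto_natCast_atTop_atTop)
    have hA : (1 : ℝ) ≤ ((n : ℝ) + 1) ^ 2 := one_le_pow₀ (by simp)
    have hN1 : (1 : ℝ) ≤ ((N : ℝ) + 1) ^ N := one_le_pow₀ (by simp)
    obtain ⟨p, hp⟩ := hcon (C * ((N : ℝ) + 1) ^ N) (((n : ℝ) + 1) ^ 2)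
      (one_le_mul_of_one_le_of_one_le hC1 hN1) hA
    refine hp ?_
    have hMp := hM.pos p
    have hAp : (1 : ℝ) ≤ (((n : ℝ) + 1) ^ 2) ^ p := one_le_pow₀ hA
    rcases le_total N p with h | h
    · refine (hN p h).mono hM.pos ?_
      gcongr
      exact le_mul_of_one_le_left (by positivity) (one_le_mul_of_one_le_of_one_le hC1 hN1)
    · refine (hC p).mono hM.pos ?_
      refine div_le_div_of_nonneg_right ?_ hMp.le
      have h1 : ((p : ℝ) + 1) ^ p ≤ ((N : ℝ) + 1) ^ N :=
        (pow_le_pow_left₀ (by positivity) (by gcongr) p).trans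
          (pow_le_pow_right₀ (by simp) h)
      calc C * ((p : ℝ) + 1) ^ p ≤ C * ((N : ℝ) + 1) ^ N := by gcongr
        _ ≤ _ := le_mul_of_one_le_right (by positivity) hAp
  obtain ⟨φ, hφ, hφbad⟩ := Filter.extraction_forall_of_frequently hfreq
  -- Diagonal choice: `g` tends to infinity but is only `n + 1` at the bad index `φ n`, where `C (n
  -- + 1) ^ p ≤ (n + 1) ^ (2p)` as soon as `C ≤ n`.
  let g : ℕ → ℝ := Function.extend φ (fun n => (n : ℝ) + 1) fun p => (p : ℝ) + 1
  have hgφ : ∀ n, g (φ n) = n + 1 := fun n => hφ.injective.extend_apply _ _ n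
  have hg' : ∀ p, (¬∃ n, φ n = p) → g p = p + 1 := fun p hp => Function.extend_apply' _ _ _ hp
  obtain ⟨C, hC1, hC⟩ := hbound g (fun p => by
      by_cases hp : ∃ n, φ n = p
      · obtain ⟨n, rfl⟩ := hp
        simp [hgφ]
      · simp [hg' p hp]) (by
      refine Filter.tendsto_atTop.2 fun b => ?_
      obtain ⟨N, hN⟩ := exists_nat_ge b
      filter_upwards [Filter.eventually_ge_atTop (max N (φ N))] with p hp
      by_cases hp' : ∃ n, φ n = p
      · obtain ⟨n, rfl⟩ := hp'
        have : N ≤ n := hφ.le_iff_le.1 ((le_max_right _ _).trans hp)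
        have : (N : ℝ) ≤ n := by exact_mod_cast this
        rw [hgφ]; linarith
      · have : (N : ℝ) ≤ p := by exact_mod_cast (le_max_left _ _).trans hp
        rw [hg' p hp']; linarith)
  obtain ⟨n, hn⟩ := exists_nat_ge C
  have hn1 : 1 ≤ n := by
    have : (1 : ℝ) ≤ n := hC1.trans hn
    exact_mod_cast this
  refine hφbad n ((hC (φ n)).mono hM.pos ?_)
  have hMp := hM.pos (φ n)
  rw [hgφ, ← pow_mul, mul_comm 2, pow_mul, sq]
  gcongr
  have hφ1 : φ n ≠ 0 := by
    have := hφ.id_le n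
    simp only [id] at this
    omega
  calc C ≤ (n : ℝ) + 1 := by linarith
    _ ≤ ((n : ℝ) + 1) ^ φ n := le_self_pow₀ (by simp) hφ1

/-! ### Jensen's inequality in the half-plane. -/

/-- If a bounded holomorphic function in the right half-plane is small near the origin, as measured
by the factors `min 1 (m_k |ζ| ^ r)`, and not small at the point `R`, then the `m_k` are sparse. -/
theorem sum_rpow_le_of_halfPlane {ι : Type*} {s : Finset ι} {m : ι → ℝ} {r L R : ℝ} (hr : 0 < r)
    (hL : 1 ≤ L) (hR : 0 < R) (hm : ∀ k ∈ s, 0 < m k) (hmR : ∀ k ∈ s, 1 ≤ m k * R ^ r) {G : ℂ → ℂ}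
    (hG : DifferentiableOn ℂ G {ζ | 0 < ζ.re})
    (hbound : ∀ ζ : ℂ, 0 < ζ.re → ‖G ζ‖ ≤ 2 * L * ∏ k ∈ s, min 1 (m k * ‖ζ‖ ^ r))
    (hGR : 1 / 2 ≤ ‖G R‖) :
    ∑ k ∈ s, m k ^ (-(1 / r)) ≤ 2 * Real.pi * Real.exp (1 / r) * Real.log (4 * L) * R := by
  set σ : ι → ℝ := fun k => Real.exp (-(1 / r)) * m k ^ (-(1 / r)) with hσ
  have hσ0 : ∀ k ∈ s, 0 < σ k := fun k hk =>
    mul_pos (Real.exp_pos _) (Real.rpow_pos_of_pos (hm k hk) _)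
  have hσr : ∀ k ∈ s, m k * σ k ^ r = Real.exp (-1) := fun k hk => by
    have hmk := hm k hk
    rw [hσ, Real.mul_rpow (Real.exp_pos _).le (Real.rpow_nonneg hmk.le _), ← Real.exp_mul,
      ← Real.rpow_mul hmk.le]
    have : -(1 / r) * r = -1 := by field_simp
    rw [this, Real.rpow_neg_one]
    field_simp
  have hσR : ∀ k ∈ s, σ k ≤ R := fun k hk => by
    have hmk := hm k hk
    refine (Real.rpow_le_rpow_iff (hσ0 k hk).le hR.le hr).1 ?_
    refine le_of_mul_le_mul_left ?_ hmk
    rw [hσr k hk]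
    exact (Real.exp_le_one_iff.2 (by norm_num)).trans (hmR k hk)
  -- The gap `ε` keeps the circle inside the open half-plane; `ε < σ k / 2` leaves half of `σ k` for
  -- the chord, hence the half-angle `σ k / (2 * R)`.
  obtain ⟨ε, hε0, hεR, hεσ⟩ : ∃ ε : ℝ, 0 < ε ∧ ε < R ∧ ∀ k ∈ s, ε < σ k / 2 := by
    have h1 : ∀ᶠ ε : ℝ in nhdsWithin 0 (Set.Ioi 0), ∀ k ∈ s, ε < σ k / 2 :=
      (Filter.eventually_all_finset s).2 fun k hk =>
        nhdsWithin_le_nhds (Iio_mem_nhds (half_pos (hσ0 k hk)))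
    have h2 : ∀ᶠ ε : ℝ in nhdsWithin 0 (Set.Ioi 0), ε < R :=
      nhdsWithin_le_nhds (Iio_mem_nhds hR)
    have h3 : ∀ᶠ ε : ℝ in nhdsWithin 0 (Set.Ioi 0), 0 < ε := self_mem_nhdsWithin
    exact (h3.and (h2.and h1)).exists
  set ρ := R - ε with hρ
  have hρ0 : 0 < ρ := by linarith
  have hre : ∀ ζ ∈ Metric.closedBall (R : ℂ) ρ, 0 < ζ.re := by
    intro ζ hζ
    have h1 : |(ζ - R).re| ≤ ρ :=
      (Complex.abs_re_le_norm _).trans (by simpa [dist_eq_norm] using hζ)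
    simp only [Complex.sub_re, Complex.ofReal_re] at h1
    linarith [(abs_le.1 h1).1]
  have hnorm : ∀ ζ ∈ Metric.sphere (R : ℂ) ρ, 0 < ‖ζ‖ := fun ζ hζ =>
    norm_pos_iff.2 fun h => by
      have := hre ζ (Metric.sphere_subset_closedBall hζ)
      simp [h] at this
  let u : ι → ℂ → ℝ := fun k ζ => -Real.log (min 1 (m k * ‖ζ‖ ^ r))
  have hmin : ∀ k ∈ s, ∀ ζ ∈ Metric.sphere (R : ℂ) ρ, 0 < min 1 (m k * ‖ζ‖ ^ r) :=
    fun k hk ζ hζ => lt_min one_pos (mul_pos (hm k hk) (Real.rpow_pos_of_pos (hnorm ζ hζ) _))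
  have hucont : ∀ k ∈ s, ContinuousOn (u k) (Metric.sphere (R : ℂ) ρ) := by
    intro k hk
    refine (ContinuousOn.log ?_ fun ζ hζ => (hmin k hk ζ hζ).ne').neg
    refine continuousOn_const.inf (continuousOn_const.mul ?_)
    exact continuous_norm.continuousOn.rpow_const fun ζ hζ => Or.inl (hnorm ζ hζ).ne'
  have huint : ∀ k ∈ s, CircleIntegrable (u k) R ρ :=
    fun k hk => (hucont k hk).circleIntegrable hρ0.le
  have huavg : ∀ k ∈ s, σ k / (2 * R) / Real.pi ≤ Real.circleAverage (u k) R ρ := by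
    intro k hk
    have hσk := hσ0 k hk
    have hd : σ k / (2 * R) ≤ 1 / 2 := by
      rw [div_le_div_iff₀ (by positivity) (by norm_num)]
      linarith [hσR k hk]
    refine le_circleAverage_of_one_le_near_zero (s := σ k) hρ0 (by linarith) (by positivity)
      (by linarith [Real.pi_gt_three]) ?_ (hucont k hk) ?_ ?_
    · have : ρ * (σ k / (2 * R)) ≤ R * (σ k / (2 * R)) := by gcongr; linarith
      have h2 : R * (σ k / (2 * R)) = σ k / 2 := by field_simp
      linarith [hεσ k hk]
    · intro ζ hζ
      exact neg_nonneg.2 (Real.log_nonpos (hmin k hk ζ hζ).le (min_le_left _ _))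
    · intro ζ hζ hζσ
      have h1 : m k * ‖ζ‖ ^ r ≤ Real.exp (-1) := by
        rw [← hσr k hk]
        have := hm k hk
        gcongr
      have h2 : Real.log (min 1 (m k * ‖ζ‖ ^ r)) ≤ -1 :=
        (Real.log_le_iff_le_exp (hmin k hk ζ hζ)).2 ((min_le_right _ _).trans h1)
      simp only [u]
      linarith
  have hsumint : CircleIntegrable (fun ζ => ∑ k ∈ s, u k ζ) R ρ :=
    (continuousOn_finsetSum s hucont).circleIntegrable hρ0.le
  have hcint : CircleIntegrable (fun _ : ℂ => Real.log (2 * L)) R ρ :=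
    continuousOn_const.circleIntegrable hρ0.le
  have hjensen := log_norm_center_le_circleAverage hρ0 (f := G) (c := (R : ℂ))
    (U := fun ζ => Real.log (2 * L) - ∑ k ∈ s, u k ζ)
    ((hG.analyticOnNhd (isOpen_lt continuous_const Complex.continuous_re)).mono hre)
    (norm_pos_iff.1 (lt_of_lt_of_le (by norm_num) hGR)) (hcint.sub hsumint) fun ζ hζ => by
      refine (hbound ζ (hre ζ (Metric.sphere_subset_closedBall hζ))).trans_eq ?_
      rw [Real.exp_sub, Real.exp_log (by linarith), Real.exp_sum, div_eq_mul_inv,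
        ← Finset.prod_inv_distrib]
      congr 1
      refine Finset.prod_congr rfl fun k hk => ?_
      simp only [u]
      rw [Real.exp_neg, inv_inv, Real.exp_log (hmin k hk ζ hζ)]
  rw [Real.circleAverage_fun_sub hcint hsumint, Real.circleAverage_const,
    Real.circleAverage_fun_sum huint] at hjensen
  have hlow : -Real.log 2 ≤ Real.log ‖G R‖ := by
    rw [← Real.log_inv, ← one_div]
    exact Real.log_le_log (by norm_num) hGR
  have hsum := Finset.sum_le_sum huavg
  rw [← Finset.sum_div, ← Finset.sum_div] at hsum
  have hlog : Real.log (4 * L) = Real.log 2 + Real.log (2 * L) := by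
    rw [← Real.log_mul (by norm_num) (by linarith)]; ring_nf
  have hfinal : (∑ k ∈ s, σ k) / (2 * R) / Real.pi ≤ Real.log (4 * L) := by linarith
  have hpi := Real.pi_pos
  rw [div_le_iff₀ hpi, div_le_iff₀ (by positivity)] at hfinal
  have hσsum : ∑ k ∈ s, m k ^ (-(1 / r)) = Real.exp (1 / r) * ∑ k ∈ s, σ k := by
    rw [hσ, ← Finset.mul_sum, ← mul_assoc, ← Real.exp_add]
    simp
  rw [hσsum]
  calc _ ≤ Real.exp (1 / r) * (Real.log (4 * L) * Real.pi * (2 * R)) := by gcongr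
    _ = _ := by ring

/-! ### Application to the lifts of monomials. -/

theorem IsWeightSequence.quot_pos {M : ℕ → ℝ} (hM : IsWeightSequence M) (k : ℕ) : 0 < quot M k :=
  div_pos (hM.pos _) (hM.pos _)

theorem IsWeightSequence.quot_monotone {M : ℕ → ℝ} (hM : IsWeightSequence M) :
    Monotone (quot M) := by
  refine monotone_nat_of_le_succ fun k => ?_
  rw [quot, quot, div_le_div_iff₀ (hM.pos _) (hM.pos _)]
  nlinarith [hM.logConvex k]

theorem IsWeightSequence.eq_mul_prod_quot {M : ℕ → ℝ} (hM : IsWeightSequence M) {p j : ℕ}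
    (hpj : p ≤ j) : M j = M p * ∏ k ∈ Finset.Ico p j, quot M k := by
  induction j, hpj using Nat.le_induction with
  | base => simp
  | succ j hpj ih =>
    rw [Finset.prod_Ico_succ_top hpj, ← mul_assoc, ← ih, quot, mul_div_cancel₀ _ (hM.pos j).ne']

/-- Since `m` is monotone, the factors below `1` form an initial segment, so a single order `j`
realizes the product of minima. This `j` is the optimal order of the expansion at `|z| = t`. -/
theorem exists_prod_Ico_eq_prod_min {m : ℕ → ℝ} (hmono : Monotone m) {t : ℝ}
    (ht : 0 < t) {p N : ℕ} (hpN : p ≤ N) :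
    ∃ j, p ≤ j ∧ ∏ k ∈ Finset.Ico p j, (m k * t) = ∏ k ∈ Finset.Ico p N, min 1 (m k * t) := by
  induction N, hpN using Nat.le_induction with
  | base => exact ⟨p, le_rfl, by simp⟩
  | succ N hpN ih =>
    rcases le_total 1 (m N * t) with h | h
    · obtain ⟨j, hj, hj'⟩ := ih
      exact ⟨j, hj, by rw [Finset.prod_Ico_succ_top hpN, ← hj', min_eq_left h, mul_one]⟩
    · refine ⟨N + 1, by omega, Finset.prod_congr rfl fun k hk => ?_⟩
      have hkN : k ≤ N := by have := (Finset.mem_Ico.1 hk).2; omega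
      rw [min_eq_right]
      exact (mul_le_mul_of_nonneg_right (hmono hkN) ht.le).trans h

/-- The power map of the right half-plane onto the sector `S_r`. -/
def powSector (r : ℝ) (ζ : ℂ) : LogSurface := ⟨r * Complex.log ζ⟩

theorem powSector_mem {r : ℝ} (hr : 0 < r) {ζ : ℂ} (hζ : 0 < ζ.re) :
    powSector r ζ ∈ sector r := by
  have h := Complex.abs_arg_lt_pi_div_two_iff.2 (Or.inl hζ)
  have : |r * ζ.arg| < r * Real.pi / 2 := by
    rw [abs_mul, abs_of_pos hr, mul_div_assoc]
    gcongr
  simpa [powSector, sector, LogSurface.arg, Complex.log_im] using this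

theorem norm_toComplex_powSector (r : ℝ) {ζ : ℂ} (hζ : ζ ≠ 0) :
    ‖(powSector r ζ).toComplex‖ = ‖ζ‖ ^ r := by
  rw [LogSurface.norm_toComplex, Real.rpow_def_of_pos (norm_pos_iff.2 hζ)]
  simp [powSector, mul_comm, Complex.log_re]

theorem differentiableOn_comp_powSector {r : ℝ} (hr : 0 < r) {f : LogSurface → ℂ}
    (hf : LogSurface.HolomorphicOn f (sector r)) :
    DifferentiableOn ℂ (fun ζ => f (powSector r ζ)) {ζ | 0 < ζ.re} := by
  have h : DifferentiableOn ℂ (fun ζ : ℂ => (r : ℂ) * Complex.log ζ) {ζ | 0 < ζ.re} :=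
    DifferentiableOn.const_mul (fun ζ hζ =>
      (Complex.differentiableAt_log (Or.inl hζ)).differentiableWithinAt) _
  exact DifferentiableOn.comp (g := fun w : ℂ => f ⟨w⟩)
    (t := {w : ℂ | (⟨w⟩ : LogSurface) ∈ sector r}) hf h
    fun ζ hζ => powSector_mem hr hζ

theorem sum_quot_rpow_le {M : ℕ → ℝ} (hM : IsWeightSequence M) {r : ℝ} (hr : 0 < r) {C A : ℝ}
    (hC : 1 ≤ C) (hA : 1 ≤ A) {q N : ℕ} (hq : 1 ≤ q) (hN : 2 * q ≤ N)
    (hlift : HasMonomialLift M r (2 * q) (C * A ^ (2 * q) / M (2 * q))) :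
    ∑ k ∈ Finset.Ico (2 * q) N, quot M k ^ (-(1 / r))
      ≤ 2 * Real.pi * Real.exp (1 / r) * (Real.log (4 * C) + 2 * Real.log A)
        * (2 * C * A ^ 2) ^ (1 / r) * q * quot M q ^ (-(1 / r)) := by
  obtain ⟨f, hf, hb⟩ := hlift
  set p := 2 * q with hp
  set L := C * A ^ p with hL
  have hMp := hM.pos p
  have hmq := hM.quot_pos q
  have hL1 : 1 ≤ L := one_le_mul_of_one_le_of_one_le hC (one_le_pow₀ hA)
  have hz0 : ∀ z : LogSurface, 0 < ‖z.toComplex‖ := fun z => norm_pos_iff.2 z.toComplex_ne_zero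
  have hsum0 : ∀ j ≤ p, ∀ z : LogSurface, ∑ n ∈ Finset.range j,
      PowerSeries.coeff n (PowerSeries.X ^ p : PowerSeries ℂ) * z.toComplex ^ n = 0 := by
    intro j hj z
    refine Finset.sum_eq_zero fun n hn => ?_
    have := Finset.mem_range.1 hn
    rw [PowerSeries.coeff_X_pow, if_neg (by omega), zero_mul]
  have hsum1 : ∀ j, p < j → ∀ z : LogSurface, ∑ n ∈ Finset.range j,
      PowerSeries.coeff n (PowerSeries.X ^ p : PowerSeries ℂ) * z.toComplex ^ n
        = z.toComplex ^ p := by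
    intro j hj z
    simp [PowerSeries.coeff_X_pow, hj]
  have hlow : ∀ j ≤ p, ∀ z ∈ sector r,
      ‖f z / z.toComplex ^ p‖ * ‖z.toComplex‖ ^ (p - j) ≤ L * (M j / M p) := by
    intro j hj z hz
    have h1 := hb j z hz
    rw [hsum0 j hj, sub_zero] at h1
    have h2 : ‖z.toComplex‖ ^ p = ‖z.toComplex‖ ^ (p - j) * ‖z.toComplex‖ ^ j := by
      rw [← pow_add, Nat.sub_add_cancel hj]
    have h3 := hz0 z
    rw [norm_div, norm_pow, h2]
    calc _ = ‖f z‖ / ‖z.toComplex‖ ^ j := by field_simp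
      _ ≤ L / M p * M j := by rwa [div_le_iff₀ (by positivity)]
      _ = _ := by ring
  -- The factor `2` pays for `j = p`, where the partial sum still omits `z ^ p` and one only has `L
  -- + 1 ≤ 2 * L`.
  have hhigh : ∀ j, p ≤ j → ∀ z ∈ sector r,
      ‖f z / z.toComplex ^ p - 1‖ ≤ 2 * L * ∏ k ∈ Finset.Ico p j, (quot M k * ‖z.toComplex‖) := by
    intro j hj z hz
    rcases hj.eq_or_lt with rfl | hj'
    · have h1 := hlow p le_rfl z hz
      rw [Nat.sub_self, pow_zero, mul_one, div_self hMp.ne', mul_one] at h1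
      have h2 := norm_sub_le (f z / z.toComplex ^ p) 1
      rw [norm_one] at h2
      simp only [Finset.Ico_self, Finset.prod_empty, mul_one]
      linarith
    · have h1 := hb j z hz
      rw [hsum1 j hj'] at h1
      have h3 := hz0 z
      have h4 : f z / z.toComplex ^ p - 1 = (f z - z.toComplex ^ p) / z.toComplex ^ p := by
        have := z.toComplex_ne_zero
        field_simp
      have h5 : ‖z.toComplex‖ ^ j = ‖z.toComplex‖ ^ (j - p) * ‖z.toComplex‖ ^ p := by
        rw [← pow_add, Nat.sub_add_cancel hj]
      have h6 : 0 ≤ ∏ k ∈ Finset.Ico p j, (quot M k * ‖z.toComplex‖) :=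
        Finset.prod_nonneg fun k _ => mul_nonneg (hM.quot_pos k).le h3.le
      rw [h4, norm_div, norm_pow, div_le_iff₀ (by positivity)]
      refine h1.trans ?_
      calc L / M p * M j * ‖z.toComplex‖ ^ j
          = 1 * L * (∏ k ∈ Finset.Ico p j, (quot M k * ‖z.toComplex‖)) * ‖z.toComplex‖ ^ p := by
            rw [hM.eq_mul_prod_quot hj, h5, Finset.prod_mul_distrib, Finset.prod_const, Nat.card_Ico]
            field_simp
        _ ≤ 2 * L * (∏ k ∈ Finset.Ico p j, (quot M k * ‖z.toComplex‖)) * ‖z.toComplex‖ ^ p := by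
            gcongr
            norm_num
  -- `B` is chosen so that `B ^ q ≥ 2 * L`; `R` corresponds to `|z| = B / quot M q`.
  set B : ℝ := 2 * C * A ^ 2 with hB
  have hB1 : 1 ≤ B := by
    have : 1 ≤ C * A ^ 2 := one_le_mul_of_one_le_of_one_le hC (one_le_pow₀ hA)
    rw [hB, mul_assoc]; linarith
  have hB0 : 0 < B := by linarith
  set R : ℝ := (B / quot M q) ^ (1 / r) with hR
  have hR0 : 0 < R := by positivity
  have hRr : R ^ r = B / quot M q := by
    rw [hR, ← Real.rpow_mul (by positivity), one_div_mul_cancel hr.ne', Real.rpow_one]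
  have hne : ∀ ζ : ℂ, 0 < ζ.re → ζ ≠ 0 := fun ζ hζ h => by simp [h] at hζ
  have hmain := sum_rpow_le_of_halfPlane (s := Finset.Ico p N) (m := quot M) hr hL1 hR0
    (fun k _ => hM.quot_pos k) (fun k hk => by
      have hqk : q ≤ k := by have := (Finset.mem_Ico.1 hk).1; omega
      rw [hRr, mul_div_assoc', le_div_iff₀ hmq, one_mul]
      calc quot M q ≤ quot M k := hM.quot_monotone hqk
        _ ≤ quot M k * B := le_mul_of_one_le_right (hM.quot_pos k).le hB1)
    (G := fun ζ => f (powSector r ζ) / (powSector r ζ).toComplex ^ p - 1) (by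
      refine ((differentiableOn_comp_powSector hr hf).div
        (DifferentiableOn.pow (differentiableOn_comp_powSector hr ?_) p)
        fun ζ _ => pow_ne_zero _ (powSector r ζ).toComplex_ne_zero).sub_const 1
      exact Complex.differentiable_exp.differentiableOn) (by
      intro ζ hζ
      obtain ⟨j, hj, hj'⟩ := exists_prod_Ico_eq_prod_min hM.quot_monotone
        (hz0 (powSector r ζ)) hN
      have h1 := hhigh j hj _ (powSector_mem hr hζ)
      rw [hj'] at h1
      simpa only [norm_toComplex_powSector r (hne ζ hζ)] using h1) (by
      have hre : 0 < (R : ℂ).re := by simpa using hR0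
      -- Order `q`, half of `p`: with `M q * quot M q ^ q ≤ M p` the remainder gives `‖F‖ ≤ L / B ^
      -- q ≤ 1 / 2`.
      have h1 := hlow q (by omega) _ (powSector_mem hr hre)
      rw [norm_toComplex_powSector r (hne _ hre), Complex.norm_real, Real.norm_of_nonneg hR0.le,
        hRr, show p - q = q by omega] at h1
      set F := f (powSector r R) / (powSector r R).toComplex ^ p
      have hMpq : M q * quot M q ^ q ≤ M p := by
        rw [hM.eq_mul_prod_quot (show q ≤ p by omega)]
        have := hM.pos q
        gcongr
        have h2 := Finset.prod_le_prod (s := Finset.Ico q p) (f := fun _ => quot M q)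
          (fun _ _ => hmq.le) fun k hk => hM.quot_monotone (Finset.mem_Ico.1 hk).1
        rwa [Finset.prod_const, Nat.card_Ico, show p - q = q by omega] at h2
      have h3 : ‖F‖ * B ^ q ≤ L := by
        have hMq := hM.pos q
        rw [div_pow, mul_div_assoc', div_le_iff₀ (by positivity)] at h1
        refine h1.trans ?_
        rw [mul_assoc]
        refine mul_le_of_le_one_right (by linarith) ?_
        rw [div_mul_eq_mul_div, div_le_one hMp]
        exact hMpq
      have h4 : 2 * L ≤ B ^ q := by
        have h5 : 2 * C ≤ (2 * C) ^ q := le_self_pow₀ (by linarith) (by omega)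
        rw [hB, mul_pow, ← pow_mul, ← hp, hL, ← mul_assoc]
        gcongr
      have h6 : ‖F‖ ≤ 1 / 2 := by
        by_contra hcon
        push Not at hcon
        nlinarith
      have h7 := norm_sub_norm_le 1 F
      rw [norm_one, norm_sub_rev] at h7
      linarith)
  refine hmain.trans ?_
  -- Geometric growth of the lifts is decisive here: `log L` is only linear in `q`.
  have hlogL : Real.log (4 * L) ≤ (Real.log (4 * C) + 2 * Real.log A) * q := by
    rw [hL, ← mul_assoc, Real.log_mul (by positivity) (by positivity), Real.log_pow, hp]
    have h1 : 0 ≤ Real.log (4 * C) := Real.log_nonneg (by linarith)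
    have h2 : (1 : ℝ) ≤ q := by exact_mod_cast hq
    push_cast
    nlinarith
  have hRq : R = B ^ (1 / r) * quot M q ^ (-(1 / r)) := by
    rw [hR, Real.div_rpow hB0.le hmq.le, Real.rpow_neg hmq.le, div_eq_mul_inv]
  calc _ ≤ 2 * Real.pi * Real.exp (1 / r) * ((Real.log (4 * C) + 2 * Real.log A) * q) * R := by
        have := Real.pi_pos
        gcongr
    _ = _ := by rw [hRq]; ring

/-! ### From the tail condition to the index. -/

theorem exists_sum_quot_rpow_le {M : ℕ → ℝ} (hM : IsWeightSequence M) {r : ℝ} (hr : 0 < r)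
    (hsurj : Function.Surjective (borelMap M hr)) :
    ∃ D : ℝ, 1 ≤ D ∧ ∀ q N : ℕ, ∑ k ∈ Finset.Ico q N, quot M k ^ (-(1 / r))
      ≤ D * (q + 1) * quot M q ^ (-(1 / r)) := by
  obtain ⟨C, A, hC, hA, hlift⟩ := exists_monomialLift_geometric hM hr hsurj
  set E : ℝ := 2 * Real.pi * Real.exp (1 / r) * (Real.log (4 * C) + 2 * Real.log A)
        * (2 * C * A ^ 2) ^ (1 / r) with hE
  have hE0 : 0 ≤ E := by
    have := Real.pi_pos
    have := Real.log_nonneg hA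
    have : 0 ≤ Real.log (4 * C) := Real.log_nonneg (by linarith)
    positivity
  set x : ℕ → ℝ := fun k => quot M k ^ (-(1 / r)) with hxdef
  have hx : ∀ k, 0 < x k := fun k => Real.rpow_pos_of_pos (hM.quot_pos k) _
  have hanti : Antitone x := fun i j hij =>
    Real.rpow_le_rpow_of_nonpos (hM.quot_pos i) (hM.quot_monotone hij)
      (neg_nonpos.2 (by positivity))
  have hpos : ∀ q N : ℕ, 1 ≤ q → ∑ k ∈ Finset.Ico q N, x k ≤ (1 + E) * q * x q := by
    intro q N hq
    calc ∑ k ∈ Finset.Ico q N, x k ≤ ∑ k ∈ Finset.Ico q (max N (2 * q)), x k :=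
          Finset.sum_le_sum_of_subset_of_nonneg
            (Finset.Ico_subset_Ico_right (le_max_left _ _)) fun k _ _ => (hx k).le
      _ = ∑ k ∈ Finset.Ico q (2 * q), x k + ∑ k ∈ Finset.Ico (2 * q) (max N (2 * q)), x k :=
          (Finset.sum_Ico_consecutive _ (by omega) (le_max_right _ _)).symm
      _ ≤ q * x q + E * q * x q := by
          refine add_le_add ?_
            (sum_quot_rpow_le hM hr hC hA hq (le_max_right _ _) (hlift _))
          have := Finset.sum_le_card_nsmul (Finset.Ico q (2 * q)) x (x q) fun k hk =>
            hanti (Finset.mem_Ico.1 hk).1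
          rwa [Nat.card_Ico, show 2 * q - q = q by omega, nsmul_eq_mul] at this
      _ = (1 + E) * q * x q := by ring
  -- One more than the constant in `hpos`: for `q = 0` the term `x 0` is split off and the case `q =
  -- 1` is used.
  refine ⟨2 + E, by linarith, fun q N => ?_⟩
  rcases Nat.eq_zero_or_pos q with rfl | hq
  · have h1 := hpos 1 N le_rfl
    have h2 : ∑ k ∈ Finset.Ico 0 N, x k ≤ x 0 + ∑ k ∈ Finset.Ico 1 N, x k := by
      rcases Nat.eq_zero_or_pos N with rfl | hN
      · simpa using (hx 0).le
      · rw [Finset.sum_eq_sum_Ico_succ_bot hN]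
    have h3 : x 1 ≤ x 0 := hanti (by omega)
    have h4 : (1 + E) * x 1 ≤ (1 + E) * x 0 := by gcongr
    push_cast at h1 ⊢
    change ∑ k ∈ Finset.Ico 0 N, x k ≤ (2 + E) * (0 + 1) * x 0
    linarith
  · refine (hpos q N hq).trans ?_
    have := hx q
    gcongr <;> linarith

/-- Surjectivity of the Borel map in `S_r` forces `γ(M) > r`. -/
theorem lt_gammaIndex_of_surjective {M : ℕ → ℝ} (hM : IsWeightSequence M) {r : ℝ} (hr : 0 < r)
    (hsurj : Function.Surjective (borelMap M hr)) : ENNReal.ofReal r < gammaIndex M := by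
  obtain ⟨D, hD, hsum⟩ := exists_sum_quot_rpow_le hM hr hsurj
  have hD0 : 0 < D := by linarith
  set s : ℝ := 1 + 1 / D with hs
  have hs1 : 1 < s := by rw [hs]; linarith [show 0 < 1 / D by positivity]
  have hrs : r < r * s := lt_mul_of_one_lt_right hr hs1
  -- The exponent `r * s > r` is itself admissible in the supremum, which makes the inequality
  -- strict; the constant is that of `mul_rpow_almost_decreasing` raised to the power `r`.
  refine lt_of_lt_of_le ((ENNReal.ofReal_lt_ofReal_iff (hr.trans hrs)).2 hrs)
    (le_sSup ⟨r * s, ⟨hr.trans hrs, (2 ^ s * D) ^ r, by positivity, fun p n hpn => ?_⟩, rfl⟩)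
  have hanti : Antitone fun k => quot M k ^ (-(1 / r)) := fun i j hij =>
    Real.rpow_le_rpow_of_nonpos (hM.quot_pos i) (hM.quot_monotone hij)
      (neg_nonpos.2 (by positivity))
  have h1 := mul_rpow_almost_decreasing
    (fun k => Real.rpow_pos_of_pos (hM.quot_pos k) (-(1 / r))) hanti hD hsum hpn
  rw [← hs] at h1
  have hpow : ∀ k : ℕ, (quot M k ^ (-(1 / r)) * ((k : ℝ) + 1) ^ s) ^ r
      = (quot M k / ((k : ℝ) + 1) ^ (r * s))⁻¹ := by
    intro k
    have hk := hM.quot_pos k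
    have hk1 : (0 : ℝ) < k + 1 := by positivity
    rw [Real.mul_rpow (by positivity) (by positivity), ← Real.rpow_mul hk.le,
      ← Real.rpow_mul hk1.le, show -(1 / r) * r = -1 by field_simp, Real.rpow_neg_one, inv_div,
      mul_comm s r, div_eq_mul_inv, mul_comm]
  have hn := hM.quot_pos n
  have hp := hM.quot_pos p
  have h2 := Real.rpow_le_rpow (by positivity) h1 hr.le
  rw [hpow, Real.mul_rpow (by positivity) (by positivity), hpow] at h2
  have hcp : 0 < quot M p / ((p : ℝ) + 1) ^ (r * s) := by positivity
  have hcn : 0 < quot M n / ((n : ℝ) + 1) ^ (r * s) := by positivity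
  set cp := quot M p / ((p : ℝ) + 1) ^ (r * s)
  set cn := quot M n / ((n : ℝ) + 1) ^ (r * s)
  rw [← div_eq_mul_inv, le_div_iff₀ hcp, inv_mul_le_iff₀ hcn] at h2
  linarith


end BeurlingBorel

end

theorem theorem4p2 (M : ℕ → ℝ) (hM : BeurlingBorel.IsWeightSequence M)
    (hdc : BeurlingBorel.DerivationClosed M) (r : ℝ) (hr : 0 < r)
    (hsurj : Function.Surjective (BeurlingBorel.borelMap M hr)) :
    ((⌊r⌋₊ : ℕ) : ENNReal) < BeurlingBorel.gammaIndex M := by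
  refine lt_of_le_of_lt ?_ (BeurlingBorel.lt_gammaIndex_of_surjective hM hr hsurj)
  rw [← ENNReal.ofReal_natCast]
  exact ENNReal.ofReal_le_ofReal (Nat.floor_le hr.le)
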